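/- Let $\alpha\in(1,2)$ be real and let $k\ge 3$ and $r\ge 1$ be integers. Then \[ \lim_{N\to\infty}\frac1N\,\#\bigl\{\,n\in\{1,\dots,N\} : \bigl(\lfloor (n+rj)^{\alpha}\rfloor\bigr)_{j=0}^{k-1}\ \text{is a strictly increasing arithmetic progression of positive integers}\,\bigr\}=\frac{1}{k-1}. \] Here $\lfloor x\rfloor$ denotes the greatest integer $\le x$. -/

import Mathlib

/-- `IsDiffConstSeq k d a` says that the finite sequence `a 0, a 1, …, a (k - 1)` consists of
positive integers, is strictly increasing, and that its `d`-th order differences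
`Δ^d a (n)`, `0 ≤ n ≤ k - d - 1` (where `Δ a (n) = a (n + 1) - a n`), form a constant sequence.
Only the values of `a` on `{0, …, k - 1}` matter. For `d = 1` these are the arithmetic
progressions of length `k` in the positive integers. -/
def IsDiffConstSeq (k d : ℕ) (a : ℕ → ℤ) : Prop :=
  (∀ j < k, 0 < a j) ∧
  StrictMonoOn a (Set.Iio k) ∧
  ∃ c : ℤ, ∀ n : ℕ, n + d < k → ((fwdDiff 1)^[d] a) n = c

/-! Write `u = n ^ α`, `v = r α n ^ (α - 1)` and `K = k - 1`. Since `α < 2`, the Taylor expansion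
gives `(n + r j) ^ α = u + j v + o(1)` uniformly for `j ≤ K`. With `x`, `y` the fractional parts of
`u`, `v`, the floors form a progression, up to boundary effects, exactly when `⌊x + j y⌋` is linear
in `j` for `0 ≤ j ≤ K`. The slope is then 0 or 1, which means `x + K y < 1` or `(1 - x) + K (1 - y)
< 1`. These are two disjoint triangles of area `1 / (2 K)` each, of total area `1 / K`.

It remains to see that `(v, u)` is equidistributed modulo 1. By Weyl's criterion
(`tendsto_cesaroMean_squareIntegral`) this is a statement on exponential sums. Those of `c n ^ β`
with `0 < β < 1` cancel by comparison with an integral (`tendsto_cesaroMean_expTwoPiI_rpow`). A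
phase involving `n ^ α` is linear on short windows, with a frequency that is itself equidistributed
(`tendsto_cesaroMean_of_locally_linear_phase`).

Equidistribution bounds from below the density of visits to an open set. Applying this to the
triangles and to the open complementary region gives both halves of the limit. -/

open Filter Topology Real MeasureTheory

/-! ### Cesàro means -/

/-- The Cesàro mean of the first `N` terms of a sequence. -/
noncomputable def cesaroMean {E : Type*} [AddCommGroup E] [Module ℝ E] (w : ℕ → E) (N : ℕ) : E :=
  (N : ℝ)⁻¹ • ∑ n ∈ Finset.range N, w n

namespace cesaroMean

section Module
variable {E : Type*} [AddCommGroup E] [Module ℝ E]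

lemma add (v w : ℕ → E) (N : ℕ) :
    cesaroMean (fun n => v n + w n) N = cesaroMean v N + cesaroMean w N := by
  simp [cesaroMean, Finset.sum_add_distrib]

lemma sub (v w : ℕ → E) (N : ℕ) :
    cesaroMean (fun n => v n - w n) N = cesaroMean v N - cesaroMean w N := by
  simp [cesaroMean, Finset.sum_sub_distrib, smul_sub]

lemma sum {ι : Type*} (s : Finset ι) (w : ι → ℕ → E) (N : ℕ) :
    cesaroMean (fun n => ∑ i ∈ s, w i n) N = ∑ i ∈ s, cesaroMean (w i) N := by
  simp only [cesaroMean]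
  rw [Finset.sum_comm, Finset.smul_sum]

end Module

lemma const_mul (c : ℂ) (w : ℕ → ℂ) (N : ℕ) :
    cesaroMean (fun n => c * w n) N = c * cesaroMean w N := by
  simp only [cesaroMean, ← Finset.mul_sum, Complex.real_smul]
  ring

lemma const_mul_real (c : ℝ) (w : ℕ → ℝ) (N : ℕ) :
    cesaroMean (fun n => c * w n) N = c * cesaroMean w N := by
  simp only [cesaroMean, ← Finset.mul_sum, smul_eq_mul]
  ring

lemma norm_le {E : Type*} [NormedAddCommGroup E] [NormedSpace ℝ E] (w : ℕ → E) (N : ℕ) :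
    ‖cesaroMean w N‖ ≤ cesaroMean (fun n => ‖w n‖) N := by
  simp only [cesaroMean, norm_smul, smul_eq_mul]
  rw [Real.norm_of_nonneg (by positivity)]
  gcongr
  exact norm_sum_le _ _

lemma mono {v w : ℕ → ℝ} (h : ∀ n, v n ≤ w n) (N : ℕ) : cesaroMean v N ≤ cesaroMean w N := by
  simp only [cesaroMean, smul_eq_mul]
  gcongr
  exact h _

lemma ofReal (w : ℕ → ℝ) (N : ℕ) :
    ((cesaroMean w N : ℝ) : ℂ) = cesaroMean (fun n => (w n : ℂ)) N := by
  simp [cesaroMean]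

lemma norm_le_of_bound {E : Type*} [NormedAddCommGroup E] [NormedSpace ℝ E] {w : ℕ → E} {C : ℝ}
    (hC : 0 ≤ C) (h : ∀ n, ‖w n‖ ≤ C) (N : ℕ) : ‖cesaroMean w N‖ ≤ C := by
  refine (norm_le w N).trans ?_
  simp only [cesaroMean, smul_eq_mul]
  calc (N : ℝ)⁻¹ * ∑ n ∈ Finset.range N, ‖w n‖
      ≤ (N : ℝ)⁻¹ * ∑ n ∈ Finset.range N, C := by gcongr; exact h _
    _ ≤ C := by
      rcases Nat.eq_zero_or_pos N with rfl | hN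
      · simpa using hC
      · have : (N : ℝ) ≠ 0 := by positivity
        simp [this]

lemma const (c : ℂ) : Tendsto (cesaroMean fun _ => c) atTop (𝓝 c) :=
  (tendsto_const_nhds (x := c)).cesaro_smul

/-- Shifting a bounded sequence does not change the asymptotics of its Cesàro means. -/
lemma shift_sub_tendsto_zero {w : ℕ → ℂ} (hw : ∀ n, ‖w n‖ ≤ 1) (h : ℕ) :
    Tendsto (fun N => cesaroMean (fun n => w (n + h)) N - cesaroMean w N) atTop (𝓝 0) := by
  -- Consecutive differences telescope, leaving two boundary terms of norm at most 1.
  have key (h : ℕ) :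
      Tendsto (fun N => cesaroMean (fun n => w (n + h + 1) - w (n + h)) N) atTop (𝓝 0) := by
    rw [tendsto_zero_iff_norm_tendsto_zero]
    have h0 : Tendsto (fun N : ℕ => (N : ℝ)⁻¹ * 2) atTop (𝓝 0) := by
      simpa using (tendsto_inv_atTop_nhds_zero_nat (𝕜 := ℝ)).mul_const 2
    refine squeeze_zero (fun _ => norm_nonneg _) (fun N => ?_) h0
    have := Finset.sum_range_sub (fun n => w (n + h)) N
    simp only [add_right_comm _ 1 h] at this
    simp only [cesaroMean, this, norm_smul]
    rw [Real.norm_of_nonneg (by positivity)]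
    gcongr
    calc ‖w (N + h) - w (0 + h)‖ ≤ ‖w (N + h)‖ + ‖w (0 + h)‖ := norm_sub_le _ _
      _ ≤ 2 := by linarith [hw (N + h), hw (0 + h)]
  induction h with
  | zero => simp
  | succ h ih =>
    have := (key h).add ih
    simp only [sub] at this
    simpa [add_assoc] using this

end cesaroMean

/-! ### The additive character -/

/-- The additive character `x ↦ exp (2πix)`. -/
noncomputable def expTwoPiI (x : ℝ) : ℂ := Complex.exp ((2 * π * x : ℝ) * Complex.I)

namespace expTwoPiI

@[simp] lemma norm (x : ℝ) : ‖expTwoPiI x‖ = 1 := Complex.norm_exp_ofReal_mul_I _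

@[simp] lemma zero : expTwoPiI 0 = 1 := by simp [expTwoPiI]

lemma add (x y : ℝ) : expTwoPiI (x + y) = expTwoPiI x * expTwoPiI y := by
  simp only [expTwoPiI, ← Complex.exp_add]
  congr 1
  push_cast
  ring

lemma conj (x : ℝ) : (starRingEnd ℂ) (expTwoPiI x) = expTwoPiI (-x) := by
  simp only [expTwoPiI, ← Complex.exp_conj]
  congr 1
  rw [map_mul, Complex.conj_ofReal, Complex.conj_I]
  push_cast
  ring

lemma norm_sub_one_le (x : ℝ) : ‖expTwoPiI x - 1‖ ≤ 2 * π * |x| := by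
  have := Real.norm_exp_I_mul_ofReal_sub_one_le (x := 2 * π * x)
  rw [mul_comm] at this
  refine this.trans ?_
  rw [Real.norm_eq_abs, abs_mul, abs_of_pos (by positivity)]

lemma norm_sub_le (x y : ℝ) : ‖expTwoPiI x - expTwoPiI y‖ ≤ 2 * π * |x - y| := by
  have : expTwoPiI x - expTwoPiI y = expTwoPiI y * (expTwoPiI (x - y) - 1) := by
    rw [mul_sub, ← add]; simp
  rw [this, norm_mul, norm, one_mul]
  exact norm_sub_one_le _

lemma hasDerivAt {f : ℝ → ℝ} {f' t : ℝ} (hf : HasDerivAt f f' t) :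
    HasDerivAt (fun s => expTwoPiI (f s)) (2 * π * f' * Complex.I * expTwoPiI (f t)) t := by
  have h := (((hf.const_mul (2 * π)).ofReal_comp).mul_const Complex.I).cexp
  refine h.congr_deriv ?_
  rw [expTwoPiI, Complex.ofReal_mul (2 * π) f']
  push_cast
  ring

end expTwoPiI

/-! ### Bernoulli estimates and linearisation of powers -/

lemma Real.add_rpow_sub_rpow_le {β x h : ℝ} (hβ0 : 0 ≤ β) (hβ1 : β ≤ 1) (hx : 0 < x) (hh : 0 ≤ h) :
    (x + h) ^ β - x ^ β ≤ β * h * x ^ (β - 1) := by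
  have h1 := rpow_one_add_le_one_add_mul_self (s := h / x) (by
    have : 0 ≤ h / x := by positivity
    linarith) hβ0 hβ1
  have h2 : (x + h) ^ β = x ^ β * (1 + h / x) ^ β := by
    rw [← Real.mul_rpow hx.le (by positivity)]
    congr 1
    field_simp
  rw [h2, Real.rpow_sub_one hx.ne']
  have : x ^ β * (1 + h / x) ^ β ≤ x ^ β * (1 + β * (h / x)) := by gcongr
  calc _ ≤ x ^ β * (1 + β * (h / x)) - x ^ β := by linarith
    _ = _ := by ring

lemma Real.tangent_le_add_rpow {α x h : ℝ} (hα : 1 ≤ α) (hx : 0 < x) (hh : 0 ≤ x + h) :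
    x ^ α + α * h * x ^ (α - 1) ≤ (x + h) ^ α := by
  have h1 := one_add_mul_self_le_rpow_one_add (s := h / x) (by
    rw [le_div_iff₀ hx]; linarith) hα
  have h2 : (x + h) ^ α = x ^ α * (1 + h / x) ^ α := by
    rw [← Real.mul_rpow hx.le (by
      have : 1 + h / x = (x + h) / x := by field_simp
      rw [this]; positivity)]
    congr 1
    field_simp
  rw [h2, Real.rpow_sub_one hx.ne']
  calc _ = x ^ α * (1 + α * (h / x)) := by ring
    _ ≤ _ := by gcongr

lemma tendsto_nat_succ_rpow_neg {γ : ℝ} (hγ : γ < 0) :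
    Tendsto (fun n : ℕ => ((n : ℝ) + 1) ^ γ) atTop (𝓝 0) := by
  have h := (tendsto_rpow_neg_atTop (y := -γ) (by linarith)).comp
    (tendsto_atTop_add_const_right atTop (1 : ℝ) tendsto_natCast_atTop_atTop)
  simpa [Function.comp_def] using h

lemma tendsto_rpow_shift_sub {β h : ℝ} (hβ0 : 0 ≤ β) (hβ1 : β < 1) (hh : 0 ≤ h) :
    Tendsto (fun n : ℕ => ((n : ℝ) + 1 + h) ^ β - ((n : ℝ) + 1) ^ β) atTop (𝓝 0) := by
  have h0 : Tendsto (fun n : ℕ => β * h * ((n : ℝ) + 1) ^ (β - 1)) atTop (𝓝 0) := by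
    simpa using (tendsto_nat_succ_rpow_neg (γ := β - 1) (by linarith)).const_mul (β * h)
  refine squeeze_zero (fun n => ?_) (fun n => ?_) h0
  · exact sub_nonneg.2 (Real.rpow_le_rpow (by positivity) (by linarith) hβ0)
  · exact Real.add_rpow_sub_rpow_le hβ0 hβ1.le (by positivity) hh

/-- By convexity the error lies between 0 and `h` times the increment of the derivative, which
vanishes in the limit because `α - 1 < 1`. -/
lemma tendsto_rpow_linear_error {α h : ℝ} (hα1 : 1 ≤ α) (hα2 : α < 2) (hh : 0 ≤ h) :
    Tendsto (fun n : ℕ => ((n : ℝ) + 1 + h) ^ α - ((n : ℝ) + 1) ^ α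
      - h * (α * ((n : ℝ) + 1) ^ (α - 1))) atTop (𝓝 0) := by
  have h0 := (tendsto_rpow_shift_sub (β := α - 1) (by linarith) (by linarith) hh).const_mul (α * h)
  rw [mul_zero] at h0
  refine squeeze_zero (fun n => ?_) (fun n => ?_) h0
  · have := Real.tangent_le_add_rpow (h := h) hα1 (by positivity : (0 : ℝ) < n + 1) (by positivity)
    linarith
  -- The upper bound is the tangent inequality at the right endpoint, looking back.
  · have := Real.tangent_le_add_rpow (h := -h) hα1 (by positivity : (0 : ℝ) < n + 1 + h)
      (by simp; positivity)
    simp only [add_neg_cancel_right] at this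
    linarith

/-! ### Cancellation in exponential sums -/

/-- The exponential sums of `c * n ^ β` with `0 < β < 1` cancel. -/
lemma tendsto_cesaroMean_expTwoPiI_rpow {β c : ℝ} (hβ0 : 0 < β) (hβ1 : β < 1) (hc : c ≠ 0) :
    Tendsto (cesaroMean fun n : ℕ => expTwoPiI (c * ((n : ℝ) + 1) ^ β)) atTop (𝓝 0) := by
  -- The factor `t ^ (1 - β)` cancels the derivative `t ^ (β - 1)` of the phase, so `F' = κ e(c t ^
  -- β) + O(t ^ (-β))`: `F / κ` is nearly a primitive of the summand.
  set F : ℝ → ℂ := fun t => (t ^ (1 - β) : ℝ) * expTwoPiI (c * t ^ β) with hF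
  set κ : ℂ := 2 * π * (c * β : ℝ) * Complex.I with hκ
  have hκ0 : κ ≠ 0 := by
    have := mul_ne_zero hc hβ0.ne'
    simp only [hκ]
    refine mul_ne_zero (mul_ne_zero (mul_ne_zero two_ne_zero ?_) ?_) Complex.I_ne_zero
    · exact_mod_cast Real.pi_ne_zero
    · exact_mod_cast this
  have hderiv (t : ℝ) (ht : 0 < t) : HasDerivAt F
      ((((1 - β) * t ^ (-β) : ℝ) : ℂ) * expTwoPiI (c * t ^ β) + κ * expTwoPiI (c * t ^ β)) t := by
    have h1 := (Real.hasDerivAt_rpow_const (x := t) (p := 1 - β) (Or.inl ht.ne')).ofReal_comp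
    have h2 := expTwoPiI.hasDerivAt
      ((Real.hasDerivAt_rpow_const (x := t) (p := β) (Or.inl ht.ne')).const_mul c)
    refine (h1.mul h2).congr_deriv ?_
    have h3 : t ^ (1 - β) * t ^ (β - 1) = 1 := by
      rw [← Real.rpow_add ht]; simp
    have h4 : ((t ^ (1 - β) : ℝ) : ℂ) * ((t ^ (β - 1) : ℝ) : ℂ) = 1 := by exact_mod_cast h3
    have h5 : (1 : ℝ) - β - 1 = -β := by ring
    rw [h5]
    simp only [hκ]
    push_cast
    linear_combination (2 * π * c * β * Complex.I * expTwoPiI (c * t ^ β)) * h4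
  set b : ℕ → ℝ := fun n => (1 - β) * ((n : ℝ) + 1) ^ (-β) +
    ‖κ‖ * (2 * π * (|c| * (((n : ℝ) + 1 + 1) ^ β - ((n : ℝ) + 1) ^ β))) with hb
  have hb0 : Tendsto b atTop (𝓝 0) := by
    have h1 := (tendsto_nat_succ_rpow_neg (γ := -β) (by linarith)).const_mul (1 - β)
    have h2 := (((tendsto_rpow_shift_sub hβ0.le hβ1 zero_le_one).const_mul |c|).const_mul
      (2 * π)).const_mul ‖κ‖
    simpa using h1.add h2
  have hstep (n : ℕ) :
      ‖F (n + 1 + 1) - F (n + 1) - κ * expTwoPiI (c * ((n : ℝ) + 1) ^ β)‖ ≤ b n := by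
    set x : ℝ := n + 1 with hx
    have hx0 : 0 < x := by positivity
    set e0 : ℂ := κ * expTwoPiI (c * x ^ β)
    -- Mean value inequality on a unit interval, after subtracting the linear function whose slope
    -- is the main term at the left endpoint.
    have hG (t : ℝ) (ht : t ∈ Set.Icc x (x + 1)) : HasDerivWithinAt (fun s : ℝ => F s - s * e0)
        ((((1 - β) * t ^ (-β) : ℝ) : ℂ) * expTwoPiI (c * t ^ β) + κ * expTwoPiI (c * t ^ β)
          - 1 * e0) (Set.Icc x (x + 1)) t :=
      ((hderiv t (hx0.trans_le ht.1)).sub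
        ((hasDerivAt_id t).ofReal_comp.mul_const e0)).hasDerivWithinAt
    have := (convex_Icc x (x + 1)).norm_image_sub_le_of_norm_hasDerivWithin_le hG (C := b n) ?_
      (Set.left_mem_Icc.2 (by linarith)) (Set.right_mem_Icc.2 (by linarith))
    · simp only [add_sub_cancel_left, norm_one, mul_one] at this
      have he : F (x + 1) - F x - e0
          = F (x + 1) - (x + 1 : ℝ) * e0 - (F x - x * e0) := by
        push_cast
        ring
      rw [he]
      exact this
    · intro t ht
      have ht0 : 0 < t := hx0.trans_le ht.1
      rw [one_mul, add_sub_assoc]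
      refine (norm_add_le _ _).trans (add_le_add ?_ ?_)
      · rw [norm_mul, expTwoPiI.norm, mul_one, Complex.norm_real, norm_mul,
          Real.norm_of_nonneg (by linarith), Real.norm_of_nonneg (by positivity)]
        exact mul_le_mul_of_nonneg_left (Real.rpow_le_rpow_of_nonpos hx0 ht.1 (by linarith))
          (by linarith)
      · rw [← mul_sub, norm_mul]
        gcongr
        refine (expTwoPiI.norm_sub_le _ _).trans ?_
        rw [← mul_sub, abs_mul]
        gcongr
        rw [abs_of_nonneg (sub_nonneg.2 (Real.rpow_le_rpow hx0.le ht.1 hβ0.le))]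
        gcongr
        exact ht.2
  have hdiff : Tendsto (fun n : ℕ => F (n + 1 + 1) - F (n + 1)
      - κ * expTwoPiI (c * ((n : ℝ) + 1) ^ β)) atTop (𝓝 0) :=
    squeeze_zero_norm hstep hb0
  have h1 : Tendsto (cesaroMean fun n : ℕ => F (n + 1 + 1) - F (n + 1)
      - κ * expTwoPiI (c * ((n : ℝ) + 1) ^ β)) atTop (𝓝 0) := hdiff.cesaro_smul
  -- The sum telescopes to `F (N + 1) - F 1 = O(N ^ (1 - β))`, which is `o(N)`.
  have h2 : Tendsto (cesaroMean fun n : ℕ => F (n + 1 + 1) - F (n + 1)) atTop (𝓝 0) := by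
    have ht : Tendsto (fun N : ℕ => (N : ℝ)⁻¹ * (((N : ℝ) + 1) ^ (1 - β) + 1)) atTop (𝓝 0) := by
      have hs : Tendsto (fun N : ℕ => 2 * ((N : ℝ) + 1) ^ (-β) + (N : ℝ)⁻¹) atTop (𝓝 0) := by
        simpa using ((tendsto_nat_succ_rpow_neg (γ := -β) (by linarith)).const_mul 2).add
          (tendsto_inv_atTop_nhds_zero_nat (𝕜 := ℝ))
      refine squeeze_zero' (Eventually.of_forall fun N => by positivity) ?_ hs
      filter_upwards [eventually_ge_atTop 1] with N hN
      have hN' : (1 : ℝ) ≤ N := by exact_mod_cast hN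
      rw [mul_add, mul_one, sub_eq_neg_add, Real.rpow_add_one (by positivity), ← mul_assoc,
        mul_right_comm]
      gcongr
      rw [← div_eq_inv_mul, div_le_iff₀ (by linarith)]
      linarith
    refine squeeze_zero_norm (fun N => ?_) ht
    have := Finset.sum_range_sub (fun n : ℕ => F (n + 1)) N
    push_cast at this
    simp only [cesaroMean, this, norm_smul]
    rw [Real.norm_of_nonneg (by positivity)]
    gcongr
    refine (_root_.norm_sub_le _ _).trans (add_le_add ?_ ?_) <;>
    simp only [hF, norm_mul, expTwoPiI.norm, mul_one, Complex.norm_real]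
    · rw [Real.norm_of_nonneg (by positivity)]
    · simp
  have h3 := (h2.sub h1).const_mul κ⁻¹
  simp only [← cesaroMean.sub, ← cesaroMean.const_mul, sub_sub_cancel, inv_mul_cancel_left₀ hκ0,
    sub_zero, mul_zero] at h3
  exact h3

lemma norm_sq_sum_expTwoPiI (t : ℝ) (H : ℕ) :
    ((‖∑ h ∈ Finset.range H, expTwoPiI (h * t)‖ ^ 2 : ℝ) : ℂ) =
      ∑ p ∈ Finset.range H, ∑ q ∈ Finset.range H, expTwoPiI ((((p : ℤ) - (q : ℤ) : ℤ) : ℝ) * t) := by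
  push_cast
  rw [← Complex.mul_conj', map_sum, Finset.sum_mul_sum]
  refine Finset.sum_congr rfl fun p _ => Finset.sum_congr rfl fun q _ => ?_
  rw [expTwoPiI.conj, ← expTwoPiI.add]
  congr 1
  ring

/-- Expanding the square, off-diagonal pairs average to 0 and the `H` diagonal ones contribute 1
each. -/
lemma tendsto_cesaroMean_norm_sq_sum {θ : ℕ → ℝ}
    (hθ : ∀ h : ℤ, h ≠ 0 → Tendsto (cesaroMean fun n => expTwoPiI (h * θ n)) atTop (𝓝 0)) (H : ℕ) :
    Tendsto (cesaroMean fun n => ‖∑ h ∈ Finset.range H, expTwoPiI (h * θ n)‖ ^ 2)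
      atTop (𝓝 (H : ℝ)) := by
  have h1 : Tendsto (fun N => ∑ p ∈ Finset.range H, ∑ q ∈ Finset.range H,
      cesaroMean (fun n => expTwoPiI ((((p : ℤ) - (q : ℤ) : ℤ) : ℝ) * θ n)) N) atTop
      (𝓝 (∑ p ∈ Finset.range H, ∑ q ∈ Finset.range H, if p = q then 1 else 0)) := by
    refine tendsto_finsetSum _ fun p _ => tendsto_finsetSum _ fun q _ => ?_
    split_ifs with hpq
    · simpa [hpq] using cesaroMean.const 1
    · exact hθ _ (sub_ne_zero.2 (by exact_mod_cast hpq))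
  have h2 : (∑ p ∈ Finset.range H, ∑ q ∈ Finset.range H, if p = q then (1 : ℂ) else 0) = H := by
    rw [Finset.sum_congr rfl fun p hp => by
      rw [Finset.sum_ite_eq, if_pos hp]]
    simp
  rw [h2] at h1
  simp only [← cesaroMean.sum, ← norm_sq_sum_expTwoPiI, ← cesaroMean.ofReal] at h1
  have := (Complex.continuous_re.tendsto _).comp h1
  simpa [Function.comp_def] using this

/-- If a bounded sequence looks, on windows of bounded length starting at `n`, like a linear phase
of frequency `θ n`, and `θ` is equidistributed modulo one, then its Cesàro means vanish. -/
lemma tendsto_cesaroMean_of_locally_linear_phase {w : ℕ → ℂ} {θ : ℕ → ℝ} (hw : ∀ n, ‖w n‖ ≤ 1)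
    (hloc : ∀ h : ℕ, Tendsto (fun n => w (n + h) - w n * expTwoPiI (h * θ n)) atTop (𝓝 0))
    (hθ : ∀ h : ℤ, h ≠ 0 → Tendsto (cesaroMean fun n => expTwoPiI (h * θ n)) atTop (𝓝 0)) :
    Tendsto (cesaroMean w) atTop (𝓝 0) := by
  have hstep (h : ℕ) : Tendsto (fun N => cesaroMean w N -
      cesaroMean (fun n => w n * expTwoPiI (h * θ n)) N) atTop (𝓝 0) := by
    have h1 : Tendsto (cesaroMean fun n => w (n + h) - w n * expTwoPiI (h * θ n)) atTop (𝓝 0) :=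
      (hloc h).cesaro_smul
    have := h1.sub (cesaroMean.shift_sub_tendsto_zero hw h)
    simp only [cesaroMean.sub] at this
    simpa using this
  have hwin (H : ℕ) : Tendsto (fun N => H * cesaroMean w N -
      cesaroMean (fun n => w n * ∑ h ∈ Finset.range H, expTwoPiI (h * θ n)) N) atTop (𝓝 0) := by
    have := tendsto_finsetSum (Finset.range H) fun h _ => hstep h
    simp only [Finset.sum_sub_distrib, ← cesaroMean.sum, ← Finset.mul_sum] at this
    simpa [cesaroMean.const_mul] using this
  rw [Metric.tendsto_atTop']
  intro ε hε
  -- The window length is `H = m ^ 2`. The window sum `D` then has mean square about `m ^ 2`, hence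
  -- mean norm at most `3 m / 2` by AM-GM. With an error below `m` this gives `m ^ 2 ‖mean‖ < 5 m /
  -- 2`, so the mean is below `3 / m < ε`.
  obtain ⟨m, hm⟩ := exists_nat_gt (3 / ε)
  have hm0 : (0 : ℝ) < m := lt_trans (by positivity) hm
  have hmε : 3 < ε * m := by rwa [div_lt_iff₀' hε] at hm
  have e1 := (hwin (m ^ 2)).norm.eventually_lt_const (u := (m : ℝ)) (by rwa [norm_zero])
  have e2 := (tendsto_cesaroMean_norm_sq_sum hθ (m ^ 2)).eventually_lt_const
    (u := 2 * (m : ℝ) ^ 2) (by push_cast; nlinarith [pow_pos hm0 2])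
  obtain ⟨N₀, hN₀⟩ := (e1.and e2).exists_forall_of_atTop
  refine ⟨N₀, fun N hN => ?_⟩
  obtain ⟨h1, h2⟩ := hN₀ N hN.le
  rw [dist_zero_right]
  set D : ℕ → ℂ := fun n => ∑ h ∈ Finset.range (m ^ 2), expTwoPiI (h * θ n) with hD
  have h3 : ‖cesaroMean (fun n => w n * D n) N‖ ≤ 3 / 2 * m := by
    refine (cesaroMean.norm_le _ _).trans ?_
    have hb (n : ℕ) : ‖w n * D n‖ ≤ m / 2 + (1 / (2 * m)) * ‖D n‖ ^ 2 := by
      rw [norm_mul]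
      have : ‖D n‖ ≤ m / 2 + (1 / (2 * m)) * ‖D n‖ ^ 2 := by
        have : m / 2 + (1 / (2 * m)) * ‖D n‖ ^ 2 - ‖D n‖ = (m - ‖D n‖) ^ 2 / (2 * m) := by
          field_simp
          ring
        have : 0 ≤ (m - ‖D n‖) ^ 2 / (2 * m) := by positivity
        linarith
      nlinarith [hw n, norm_nonneg (D n), norm_nonneg (w n)]
    refine (cesaroMean.mono hb N).trans ?_
    rw [cesaroMean.add, cesaroMean.const_mul_real]
    have hc : cesaroMean (fun _ => (m : ℝ) / 2) N ≤ m / 2 :=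
      (le_abs_self _).trans (cesaroMean.norm_le_of_bound (w := fun _ => (m : ℝ) / 2)
        (C := m / 2) (by positivity) (fun _ => (Real.norm_of_nonneg (by positivity)).le) N)
    have : 1 / (2 * m) * cesaroMean (fun n => ‖D n‖ ^ 2) N ≤ 1 / (2 * m) * (2 * m ^ 2) := by
      gcongr
    have h4 : 1 / (2 * (m : ℝ)) * (2 * m ^ 2) = m := by field_simp
    linarith
  have h4 : ‖((m ^ 2 : ℕ) : ℂ) * cesaroMean w N‖ < m + 3 / 2 * m := by
    calc _ = ‖(((m ^ 2 : ℕ) : ℂ) * cesaroMean w N - cesaroMean (fun n => w n * D n) N)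
          + cesaroMean (fun n => w n * D n) N‖ := by rw [sub_add_cancel]
      _ ≤ _ := norm_add_le _ _
      _ < _ := by linarith
  rw [norm_mul, Complex.norm_natCast] at h4
  push_cast at h4
  by_contra! hcon
  have : ε * m * m ≤ m ^ 2 * ‖cesaroMean w N‖ := by
    calc ε * m * m = m ^ 2 * ε := by ring
      _ ≤ _ := by gcongr
  nlinarith

/-- The exponential sums of `a n ^ α + b r α n ^ (α - 1)` cancel for `1 < α < 2` unless
`a = b = 0`. -/
lemma tendsto_cesaroMean_expTwoPiI_rpow_add_deriv {α s : ℝ} (hα1 : 1 < α) (hα2 : α < 2)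
    (hs : s ≠ 0) {a b : ℤ} (hab : ¬ (a = 0 ∧ b = 0)) :
    Tendsto (cesaroMean fun n : ℕ => expTwoPiI
      (b * (s * (α * ((n : ℝ) + 1) ^ (α - 1))) + a * ((n : ℝ) + 1) ^ α)) atTop (𝓝 0) := by
  have hα0 : α ≠ 0 := by linarith
  by_cases ha : a = 0
  · have hb : b ≠ 0 := fun hb => hab ⟨ha, hb⟩
    have := tendsto_cesaroMean_expTwoPiI_rpow (β := α - 1) (c := b * s * α) (by linarith)
      (by linarith) (mul_ne_zero (mul_ne_zero (by exact_mod_cast hb) hs) hα0)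
    simpa [ha, mul_assoc] using this
  -- The `b` term has exponent `α - 1 < 1`, so it is asymptotically constant on windows; the local
  -- frequency comes from `a` alone.
  · refine tendsto_cesaroMean_of_locally_linear_phase
      (θ := fun n => a * (α * ((n : ℝ) + 1) ^ (α - 1))) (fun n => (expTwoPiI.norm _).le) ?_ ?_
    · intro h
      have e1 := (tendsto_rpow_linear_error hα1.le hα2 (Nat.cast_nonneg h)).const_mul (a : ℝ)
      have e2 := (tendsto_rpow_shift_sub (β := α - 1) (by linarith) (by linarith)
        (Nat.cast_nonneg h)).const_mul (b * s * α)
      have e3 := ((e1.add e2).abs).const_mul (2 * π)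
      simp only [mul_zero, add_zero, abs_zero] at e3
      refine squeeze_zero_norm (fun n => ?_) e3
      rw [← expTwoPiI.add]
      refine (expTwoPiI.norm_sub_le _ _).trans (le_of_eq ?_)
      congr 2
      push_cast
      rw [add_right_comm (n : ℝ) h 1]
      ring
    · intro h hh
      have := tendsto_cesaroMean_expTwoPiI_rpow (β := α - 1) (c := h * a * α) (by linarith)
        (by linarith) (mul_ne_zero (mul_ne_zero (by exact_mod_cast hh) (by exact_mod_cast ha)) hα0)
      simpa [mul_assoc] using this

/-! ### Equidistribution on the torus -/

/-- The covering map from the plane to the two-dimensional torus. -/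
def torusMk (p : ℝ × ℝ) : UnitAddTorus (Fin 2) := ![(p.1 : UnitAddCircle), (p.2 : UnitAddCircle)]

namespace torusMk

lemma continuous : Continuous torusMk := by
  refine continuous_pi fun i => ?_
  fin_cases i
  · exact (AddCircle.continuous_mk' 1).comp continuous_fst
  · exact (AddCircle.continuous_mk' 1).comp continuous_snd

lemma isOpenMap : IsOpenMap torusMk := by
  have h : IsOpenMap (fun x : ℝ => (x : UnitAddCircle)) := QuotientAddGroup.isOpenMap_coe
  exact (Homeomorph.finTwoArrow (X := UnitAddCircle)).symm.isOpenMap.comp (h.prodMap h)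

lemma mFourier_apply (n : Fin 2 → ℤ) (p : ℝ × ℝ) :
    UnitAddTorus.mFourier n (torusMk p) = expTwoPiI (n 0 * p.1 + n 1 * p.2) := by
  rw [expTwoPiI.add]
  simp only [UnitAddTorus.mFourier, torusMk, ContinuousMap.coe_mk, Fin.prod_univ_two,
    Matrix.cons_val_zero, Matrix.cons_val_one, fourier_coe_apply, expTwoPiI]
  congr 2 <;> · push_cast; ring

end torusMk

/-- The integral over a fundamental square of a continuous function on the torus. -/
noncomputable def squareIntegral (f : C(UnitAddTorus (Fin 2), ℂ)) : ℂ :=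
  ∫ p in Set.Ioc (0 : ℝ) 1 ×ˢ Set.Ioc (0 : ℝ) 1, f (torusMk p)

namespace squareIntegral

lemma volume_square :
    volume (Set.Ioc (0 : ℝ) 1 ×ˢ Set.Ioc (0 : ℝ) 1) = 1 := by
  simp [Measure.volume_eq_prod, Measure.prod_prod]

lemma integrableOn (f : C(UnitAddTorus (Fin 2), ℂ)) :
    IntegrableOn (fun p => f (torusMk p)) (Set.Ioc (0 : ℝ) 1 ×ˢ Set.Ioc (0 : ℝ) 1) :=
  IntegrableOn.mono_set
    ((f.continuous.comp torusMk.continuous).continuousOn.integrableOn_compact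
      (isCompact_Icc.prod isCompact_Icc))
    (Set.prod_mono Set.Ioc_subset_Icc_self Set.Ioc_subset_Icc_self)

lemma add (f g : C(UnitAddTorus (Fin 2), ℂ)) :
    squareIntegral (f + g) = squareIntegral f + squareIntegral g :=
  integral_add (integrableOn f) (integrableOn g)

lemma smul (c : ℂ) (f : C(UnitAddTorus (Fin 2), ℂ)) :
    squareIntegral (c • f) = c * squareIntegral f :=
  integral_const_mul c _

lemma norm_sub_le {f g : C(UnitAddTorus (Fin 2), ℂ)} {ε : ℝ} (h : ‖f - g‖ ≤ ε) :
    ‖squareIntegral f - squareIntegral g‖ ≤ ε := by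
  rw [squareIntegral, squareIntegral, ← integral_sub (integrableOn f) (integrableOn g)]
  have := norm_setIntegral_le_of_norm_le_const (μ := volume)
    (s := Set.Ioc (0 : ℝ) 1 ×ˢ Set.Ioc (0 : ℝ) 1) (C := ε)
    (f := fun p => f (torusMk p) - g (torusMk p)) (by simp [volume_square])
    (fun p _ => ((f - g).norm_coe_le_norm (torusMk p)).trans h)
  simpa [Measure.real, volume_square] using this

lemma integral_expTwoPiI {a : ℤ} (ha : a ≠ 0) : ∫ x in Set.Ioc (0 : ℝ) 1, expTwoPiI (a * x) = 0 := by
  have hc : (2 * π * a * Complex.I : ℂ) ≠ 0 := by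
    simp [ha, Real.pi_ne_zero]
  rw [← intervalIntegral.integral_of_le zero_le_one]
  have h := integral_exp_mul_complex (a := 0) (b := 1) hc
  have he : (fun x : ℝ => expTwoPiI (a * x)) = fun x : ℝ => Complex.exp (2 * π * a * Complex.I * x) := by
    funext x
    rw [expTwoPiI]
    congr 1
    push_cast
    ring
  rw [he, h]
  have : Complex.exp (2 * π * a * Complex.I * (1 : ℝ)) = 1 := by
    rw [Complex.exp_eq_one_iff]
    exact ⟨a, by push_cast; ring⟩
  rw [this]
  simp

lemma mFourier {n : Fin 2 → ℤ} (hn : n ≠ 0) : squareIntegral (UnitAddTorus.mFourier n) = 0 := by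
  simp only [squareIntegral, torusMk.mFourier_apply, expTwoPiI.add]
  rw [Measure.volume_eq_prod, setIntegral_prod_mul (fun x => expTwoPiI (n 0 * x))
    (fun x => expTwoPiI (n 1 * x))]
  by_cases h0 : n 0 = 0
  · have h1 : n 1 ≠ 0 := fun h1 => hn (by ext i; fin_cases i <;> simp [h0, h1])
    rw [integral_expTwoPiI h1, mul_zero]
  · rw [integral_expTwoPiI h0, zero_mul]

lemma one : squareIntegral 1 = 1 := by
  simp [squareIntegral, Measure.real, volume_square]

end squareIntegral

/-- **Weyl's criterion** on the two-dimensional torus. -/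
theorem tendsto_cesaroMean_squareIntegral {z : ℕ → ℝ × ℝ}
    (hz : ∀ a b : ℤ, ¬ (a = 0 ∧ b = 0) →
      Tendsto (cesaroMean fun n => expTwoPiI (a * (z n).1 + b * (z n).2)) atTop (𝓝 0))
    (f : C(UnitAddTorus (Fin 2), ℂ)) :
    Tendsto (cesaroMean fun n => f (torusMk (z n))) atTop (𝓝 (squareIntegral f)) := by
  have hspan (g : C(UnitAddTorus (Fin 2), ℂ))
      (hg : g ∈ Submodule.span ℂ (Set.range (UnitAddTorus.mFourier (d := Fin 2)))) :
      Tendsto (cesaroMean fun n => g (torusMk (z n))) atTop (𝓝 (squareIntegral g)) := by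
    induction hg using Submodule.span_induction with
    | mem g hg =>
      obtain ⟨n, rfl⟩ := hg
      by_cases hn : n = 0
      · rw [hn, UnitAddTorus.mFourier_zero, squareIntegral.one]
        exact cesaroMean.const 1
      · rw [squareIntegral.mFourier hn]
        simp only [torusMk.mFourier_apply]
        exact hz _ _ fun h => hn (by ext i; fin_cases i <;> simp [h.1, h.2])
    | zero =>
      have : squareIntegral 0 = 0 := by simp [squareIntegral]
      rw [this]
      exact cesaroMean.const 0
    | add g h _ _ ihg ihh =>
      rw [squareIntegral.add]
      have := ihg.add ihh
      simp only [← cesaroMean.add] at this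
      exact this
    | smul c g _ ih =>
      rw [squareIntegral.smul]
      have := ih.const_mul c
      simp only [← cesaroMean.const_mul] at this
      exact this
  rw [Metric.tendsto_atTop']
  intro ε hε
  -- Trigonometric polynomials are uniformly dense, and both sides are 1-Lipschitz for the sup norm.
  have hf : f ∈ (Submodule.span ℂ
      (Set.range (UnitAddTorus.mFourier (d := Fin 2)))).topologicalClosure := by
    rw [UnitAddTorus.span_mFourier_closure_eq_top]
    trivial
  obtain ⟨g, hg, hfg⟩ := Metric.mem_closure_iff.1 hf (ε / 3) (by positivity)
  rw [dist_eq_norm] at hfg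
  obtain ⟨N₀, hN₀⟩ := ((hspan g hg).eventually
    (Metric.ball_mem_nhds _ (by positivity : 0 < ε / 3))).exists_forall_of_atTop
  refine ⟨N₀, fun N hN => ?_⟩
  have h1 := hN₀ N hN.le
  have h2 := squareIntegral.norm_sub_le hfg.le
  have h3 : ‖cesaroMean (fun n => f (torusMk (z n)) - g (torusMk (z n))) N‖ ≤ ε / 3 :=
    cesaroMean.norm_le_of_bound (by positivity)
      (fun n => ((f - g).norm_coe_le_norm _).trans hfg.le) N
  rw [cesaroMean.sub, ← dist_eq_norm] at h3
  rw [← dist_eq_norm] at h2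
  have h4 := dist_triangle4 (cesaroMean (fun n => f (torusMk (z n))) N)
    (cesaroMean (fun n => g (torusMk (z n))) N) (squareIntegral g) (squareIntegral f)
  rw [dist_comm (squareIntegral g)] at h4
  linarith

lemma fract_eq_of_coe_eq {x y : ℝ} (hx : x ∈ Set.Ioo (0 : ℝ) 1)
    (h : (x : UnitAddCircle) = (y : UnitAddCircle)) : Int.fract y = x := by
  obtain ⟨m, hm⟩ := (AddCircle.coe_eq_zero_iff 1).1
    (show ((y - x : ℝ) : UnitAddCircle) = 0 by rw [AddCircle.coe_sub, h, sub_self])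
  exact Int.fract_eq_iff.2 ⟨hx.1.le, hx.2, m, by rw [← hm]; simp⟩

/-- An equidistributed sequence in the plane modulo the integer lattice visits an open subset `T`
of the unit square, robustly in the second coordinate, with lower density at least the area
of `T`. -/
theorem exists_lt_cesaroMean_indicator_of_isOpen {z : ℕ → ℝ × ℝ}
    (hz : ∀ a b : ℤ, ¬ (a = 0 ∧ b = 0) →
      Tendsto (cesaroMean fun n => expTwoPiI (a * (z n).1 + b * (z n).2)) atTop (𝓝 0))
    {T : Set (ℝ × ℝ)} (hT : IsOpen T) (hT1 : T ⊆ Set.Ioo 0 1 ×ˢ Set.Ioo 0 1) {c : ℝ} (hc0 : 0 ≤ c)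
    (hc : c < volume.real T) :
    ∃ ε > 0, ∀ᶠ N in atTop, c < cesaroMean (Set.indicator
      {n | ∀ δ, |δ| < ε → (Int.fract (z n).1, Int.fract (z n).2 + δ) ∈ T} (1 : ℕ → ℝ)) N := by
  have hsub : Set.Ioo (0 : ℝ) 1 ×ˢ Set.Ioo (0 : ℝ) 1 ⊆ Set.Ioc 0 1 ×ˢ Set.Ioc 0 1 :=
    Set.prod_mono Set.Ioo_subset_Ioc_self Set.Ioo_subset_Ioc_self
  have hTfin : volume T ≠ ⊤ := by
    refine ne_top_of_le_ne_top ENNReal.one_ne_top ?_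
    rw [← squareIntegral.volume_square]
    exact measure_mono (hT1.trans hsub)
  -- Inner regularity leaves room for two thickenings of `ε / 2` inside `T`: one for the support of
  -- a Urysohn function, one for the perturbation `δ`.
  obtain ⟨K, hKT, hK, hcK⟩ := hT.exists_lt_isCompact
    ((ENNReal.ofReal_lt_iff_lt_toReal hc0 hTfin).2 hc)
  have hKfin : volume K ≠ ⊤ := ne_top_of_le_ne_top hTfin (measure_mono hKT)
  replace hcK := (ENNReal.ofReal_lt_iff_lt_toReal hc0 hKfin).1 hcK
  obtain ⟨ε, hε, hεT⟩ := hK.exists_thickening_subset_open hT hKT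
  set W := Metric.thickening (ε / 2) K with hW
  have hKW : K ⊆ W := Metric.self_subset_thickening (by positivity) K
  have hWT : Metric.thickening (ε / 2) W ⊆ T := by
    refine (Metric.thickening_thickening_subset _ _ _).trans ?_
    rwa [add_halves]
  have hWT' : W ⊆ T := (Metric.self_subset_thickening (by positivity) W).trans hWT
  obtain ⟨φ, hφ1, hφ0, -, hφ⟩ := exists_continuous_one_zero_of_isCompact
    (hK.image torusMk.continuous) (torusMk.isOpenMap W Metric.isOpen_thickening).isClosed_compl
    (Set.disjoint_compl_right_iff_subset.2 (Set.image_mono hKW))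
  let f : C(UnitAddTorus (Fin 2), ℂ) := ⟨fun x => (φ x : ℂ), by fun_prop⟩
  have hlim := tendsto_cesaroMean_squareIntegral hz f
  have hint : c < (squareIntegral f).re := by
    have h1 : squareIntegral f =
        ((∫ p in Set.Ioc (0 : ℝ) 1 ×ˢ Set.Ioc (0 : ℝ) 1, φ (torusMk p) : ℝ) : ℂ) :=
      integral_ofReal
    have hi : IntegrableOn (fun p => φ (torusMk p)) (Set.Ioc (0 : ℝ) 1 ×ˢ Set.Ioc (0 : ℝ) 1) :=
      (squareIntegral.integrableOn f).re
    rw [h1, Complex.ofReal_re]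
    refine hcK.trans_le ?_
    calc (volume K).toReal = ∫ p in K, (1 : ℝ) := by simp [Measure.real]
      _ = ∫ p in K, φ (torusMk p) :=
        setIntegral_congr_fun hK.measurableSet fun p hp => (hφ1 ⟨p, hp, rfl⟩).symm
      _ ≤ _ := setIntegral_mono_set hi (ae_of_all _ fun p => (hφ _).1)
        (LE.le.eventuallyLE (hKT.trans (hT1.trans hsub)))
  refine ⟨ε / 2, by positivity, ?_⟩
  have hre := ((Complex.continuous_re.tendsto _).comp hlim).eventually_const_lt hint
  filter_upwards [hre] with N hN
  refine hN.trans_le ?_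
  have h2 : cesaroMean (fun n => f (torusMk (z n))) N =
      ((cesaroMean (fun n => φ (torusMk (z n))) N : ℝ) : ℂ) := (cesaroMean.ofReal _ N).symm
  rw [Function.comp_apply, h2, Complex.ofReal_re]
  refine cesaroMean.mono (fun n => ?_) N
  by_cases hn : torusMk (z n) ∈ torusMk '' W
  -- Since `p` lies in the open unit square, equality on the torus identifies its coordinates with
  -- the fractional parts.
  · obtain ⟨p, hp, hpz⟩ := hn
    have hp1 := hT1 (hWT' hp)
    have hf1 := fract_eq_of_coe_eq hp1.1 (congrFun hpz 0)
    have hf2 := fract_eq_of_coe_eq hp1.2 (congrFun hpz 1)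
    rw [Set.indicator_of_mem]
    · exact (hφ _).2
    · intro δ hδ
      rw [hf1, hf2]
      refine hWT (Metric.mem_thickening_iff.2 ⟨p, hp, ?_⟩)
      simpa [Prod.dist_eq, Real.dist_eq] using hδ
  · rw [hφ0 hn]
    exact Set.indicator_nonneg (fun _ _ => zero_le_one) _

/-- The robust visits outside `A` are finitely many, hence of density zero; this absorbs the `o(1)`
Taylor error. -/
theorem eventually_lt_cesaroMean_indicator {z : ℕ → ℝ × ℝ}
    (hz : ∀ a b : ℤ, ¬ (a = 0 ∧ b = 0) →
      Tendsto (cesaroMean fun n => expTwoPiI (a * (z n).1 + b * (z n).2)) atTop (𝓝 0))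
    {T : Set (ℝ × ℝ)} (hT : IsOpen T) (hT1 : T ⊆ Set.Ioo 0 1 ×ˢ Set.Ioo 0 1) {A : Set ℕ}
    (hA : ∀ ε > 0, ∀ᶠ n in atTop,
      (∀ δ, |δ| < ε → (Int.fract (z n).1, Int.fract (z n).2 + δ) ∈ T) → n ∈ A)
    {c : ℝ} (hc : c < volume.real T) :
    ∀ᶠ N in atTop, c < cesaroMean (A.indicator (1 : ℕ → ℝ)) N := by
  rcases lt_or_ge c 0 with hc0 | hc0
  · refine Eventually.of_forall fun N => hc0.trans_le ?_
    simp only [cesaroMean, smul_eq_mul]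
    exact mul_nonneg (by positivity)
      (Finset.sum_nonneg fun n _ => Set.indicator_nonneg (fun _ _ => zero_le_one) _)
  obtain ⟨c', hcc', hc'⟩ := exists_between hc
  obtain ⟨ε, hε, hev⟩ := exists_lt_cesaroMean_indicator_of_isOpen hz hT hT1 (hc0.trans hcc'.le) hc'
  set G : Set ℕ := {n | ∀ δ, |δ| < ε → (Int.fract (z n).1, Int.fract (z n).2 + δ) ∈ T} with hG
  have h0 : Tendsto ((G \ A).indicator (1 : ℕ → ℝ)) atTop (𝓝 0) := by
    refine tendsto_const_nhds.congr' ?_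
    filter_upwards [hA ε hε] with n hn
    rw [Set.indicator_of_notMem]
    exact fun h => h.2 (hn h.1)
  have h1 : Tendsto (cesaroMean ((G \ A).indicator (1 : ℕ → ℝ))) atTop (𝓝 0) := h0.cesaro_smul
  filter_upwards [hev, h1.eventually_lt_const (sub_pos.2 hcc')] with N hN1 hN2
  have h2 := cesaroMean.mono (v := G.indicator (1 : ℕ → ℝ))
    (w := fun n => A.indicator 1 n + (G \ A).indicator 1 n) (fun n => by
      by_cases h : n ∈ G <;> by_cases h' : n ∈ A <;> simp [h, h']) N
  rw [cesaroMean.add] at h2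
  linarith

/-! ### The two triangles and their areas -/

/-- The width at height `y` of the triangle `x + K y < 1` in the first quadrant. -/
def triangleWidth (K y : ℝ) : ℝ := max 0 (1 - K * y)

namespace triangleWidth

@[fun_prop]
lemma continuous (K : ℝ) : Continuous (triangleWidth K) := by
  unfold triangleWidth
  fun_prop

lemma nonneg (K y : ℝ) : 0 ≤ triangleWidth K y := le_max_left _ _

lemma le_one {K y : ℝ} (hK : 0 ≤ K) (hy : 0 ≤ y) : triangleWidth K y ≤ 1 :=
  max_le zero_le_one (by nlinarith [mul_nonneg hK hy])

/-- The two affine expressions add up to `2 - K ≤ 0`, so at most one width is positive. This makes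
the triangle and its reflection through the centre of the square disjoint. -/
lemma add_reflect_le_one {K y : ℝ} (hK : 2 ≤ K) (hy : y ∈ Set.Ioo (0 : ℝ) 1) :
    triangleWidth K y + triangleWidth K (1 - y) ≤ 1 := by
  obtain ⟨h0, h1⟩ := hy
  unfold triangleWidth
  rcases max_cases 0 (1 - K * y) with h | h <;> rcases max_cases 0 (1 - K * (1 - y)) with h' | h' <;>
  rw [h.1, h'.1] <;> nlinarith

lemma integral {K : ℝ} (hK : 2 ≤ K) :
    ∫ y in (0 : ℝ)..1, triangleWidth K y = 1 / (2 * K) := by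
  have hK0 : 0 < K := by linarith
  have hi (a b : ℝ) : IntervalIntegrable (triangleWidth K) volume a b :=
    (continuous K).intervalIntegrable _ _
  rw [← intervalIntegral.integral_add_adjacent_intervals (hi 0 (1 / K)) (hi (1 / K) 1)]
  have h1 : ∫ y in (0 : ℝ)..(1 / K), triangleWidth K y = ∫ y in (0 : ℝ)..(1 / K), (1 - K * y) := by
    refine intervalIntegral.integral_congr fun y hy => max_eq_right ?_
    rw [Set.uIcc_of_le (by positivity)] at hy
    have := (le_div_iff₀' hK0).1 hy.2
    linarith
  have h2 : ∫ y in (1 / K)..1, triangleWidth K y = ∫ y in (1 / K)..1, (0 : ℝ) := by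
    refine intervalIntegral.integral_congr fun y hy => max_eq_left ?_
    rw [Set.uIcc_of_le (by rw [div_le_one hK0]; linarith)] at hy
    have := (div_le_iff₀' hK0).1 hy.1
    linarith
  rw [h1, h2, intervalIntegral.integral_sub (by simp)
    ((continuous_const_mul K).intervalIntegrable _ _), intervalIntegral.integral_const_mul]
  simp
  field_simp
  ring

lemma integral_reflect {K : ℝ} (hK : 2 ≤ K) :
    ∫ y in (0 : ℝ)..1, triangleWidth K (1 - y) = 1 / (2 * K) := by
  rw [intervalIntegral.integral_comp_sub_left (triangleWidth K)]
  simpa using integral hK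

end triangleWidth

lemma isOpen_regionBetween {f g : ℝ → ℝ} (hf : Continuous f) (hg : Continuous g) {s : Set ℝ}
    (hs : IsOpen s) : IsOpen (regionBetween f g s) :=
  (hs.preimage continuous_fst).inter
    ((isOpen_lt (hf.comp continuous_fst) continuous_snd).inter
      (isOpen_lt continuous_snd (hg.comp continuous_fst)))

lemma volume_regionBetween_Ioo {f g : ℝ → ℝ} (hf : Continuous f) (hg : Continuous g)
    (hfg : ∀ y ∈ Set.Ioo (0 : ℝ) 1, f y ≤ g y) :
    volume (regionBetween f g (Set.Ioo 0 1)) = ENNReal.ofReal (∫ y in (0 : ℝ)..1, (g y - f y)) := by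
  have hi {f : ℝ → ℝ} (hf : Continuous f) : IntegrableOn f (Set.Ioo 0 1) :=
    (hf.integrableOn_Icc).mono_set Set.Ioo_subset_Icc_self
  rw [Measure.volume_eq_prod, volume_regionBetween_eq_integral (hi hf) (hi hg) measurableSet_Ioo hfg,
    intervalIntegral.integral_of_le zero_le_one, integral_Ioc_eq_integral_Ioo]
  rfl

/-- The set of `(y, x)` in the unit square for which `⌊x + j y⌋`, `0 ≤ j ≤ K`, vanishes identically
or equals `j`, up to boundary. -/
def progressionRegion (K : ℝ) : Set (ℝ × ℝ) :=
  regionBetween (fun _ => 0) (triangleWidth K) (Set.Ioo 0 1) ∪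
    regionBetween (fun y => 1 - triangleWidth K (1 - y)) (fun _ => 1) (Set.Ioo 0 1)

/-- The complement of `progressionRegion` in the unit square, up to boundary. -/
def nonProgressionRegion (K : ℝ) : Set (ℝ × ℝ) :=
  regionBetween (triangleWidth K) (fun y => 1 - triangleWidth K (1 - y)) (Set.Ioo 0 1)

lemma isOpen_progressionRegion (K : ℝ) : IsOpen (progressionRegion K) :=
  (isOpen_regionBetween (by fun_prop) (by fun_prop) isOpen_Ioo).union
    (isOpen_regionBetween (by fun_prop) (by fun_prop) isOpen_Ioo)

lemma isOpen_nonProgressionRegion (K : ℝ) : IsOpen (nonProgressionRegion K) :=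
  isOpen_regionBetween (by fun_prop) (by fun_prop) isOpen_Ioo

lemma progressionRegion_subset {K : ℝ} (hK : 0 ≤ K) :
    progressionRegion K ⊆ Set.Ioo 0 1 ×ˢ Set.Ioo 0 1 := by
  rintro ⟨y, x⟩ (⟨hy, h1, h2⟩ | ⟨hy, h1, h2⟩)
  · exact ⟨hy, h1, h2.trans_le (triangleWidth.le_one hK hy.1.le)⟩
  · have := triangleWidth.le_one hK (sub_nonneg.2 hy.2.le)
    exact ⟨hy, lt_of_le_of_lt (sub_nonneg.2 this) h1, h2⟩

lemma nonProgressionRegion_subset (K : ℝ) :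
    nonProgressionRegion K ⊆ Set.Ioo 0 1 ×ˢ Set.Ioo 0 1 := by
  rintro ⟨y, x⟩ ⟨hy, h1, h2⟩
  exact ⟨hy, (triangleWidth.nonneg K y).trans_lt h1,
    h2.trans_le (sub_le_self _ (triangleWidth.nonneg K _))⟩

lemma volume_progressionRegion {K : ℝ} (hK : 2 ≤ K) :
    volume.real (progressionRegion K) = 1 / K := by
  have hK0 : 0 < K := by linarith
  have hd : Disjoint (regionBetween (fun _ => 0) (triangleWidth K) (Set.Ioo 0 1))
      (regionBetween (fun y => 1 - triangleWidth K (1 - y)) (fun _ => 1) (Set.Ioo 0 1)) := by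
    rw [Set.disjoint_left]
    rintro ⟨y, x⟩ ⟨hy, h1, h2⟩ ⟨-, h3, h4⟩
    have := triangleWidth.add_reflect_le_one hK hy
    simp only at h2 h3
    linarith
  rw [Measure.real, progressionRegion, measure_union hd
    (isOpen_regionBetween (by fun_prop) (by fun_prop) isOpen_Ioo).measurableSet,
    volume_regionBetween_Ioo (by fun_prop) (by fun_prop) (fun y _ => triangleWidth.nonneg K y),
    volume_regionBetween_Ioo (by fun_prop) (by fun_prop)
      (fun y _ => sub_le_self _ (triangleWidth.nonneg K _))]
  simp only [sub_zero, sub_sub_cancel]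
  rw [triangleWidth.integral hK, triangleWidth.integral_reflect hK,
    ← ENNReal.ofReal_add (by positivity) (by positivity), ENNReal.toReal_ofReal (by positivity)]
  field_simp
  norm_num

lemma volume_nonProgressionRegion {K : ℝ} (hK : 2 ≤ K) :
    volume.real (nonProgressionRegion K) = 1 - 1 / K := by
  have hK0 : 0 < K := by linarith
  have hi {f : ℝ → ℝ} (hf : Continuous f) : IntervalIntegrable f volume 0 1 :=
    hf.intervalIntegrable _ _
  rw [Measure.real, nonProgressionRegion, volume_regionBetween_Ioo (by fun_prop) (by fun_prop)
      (fun y hy => by linarith [triangleWidth.add_reflect_le_one hK hy]),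
    intervalIntegral.integral_sub (hi (by fun_prop)) (hi (by fun_prop)),
    intervalIntegral.integral_sub (hi (by fun_prop)) (hi (by fun_prop)),
    triangleWidth.integral hK, triangleWidth.integral_reflect hK, ENNReal.toReal_ofReal]
  · simp
    field_simp
    ring
  · have : 1 / (2 * K) ≤ 1 / 4 := one_div_le_one_div_of_le (by norm_num) (by linarith)
    simp at this ⊢
    linarith

/-! ### Floors and arithmetic progressions -/

lemma Int.floor_add_nat_mul_add (u v δ : ℝ) (j : ℕ) :
    ⌊u + j * v + δ⌋ = ⌊u⌋ + j * ⌊v⌋ + ⌊Int.fract u + δ + j * Int.fract v⌋ := by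
  have : u + j * v + δ =
      Int.fract u + δ + j * Int.fract v + ((⌊u⌋ + j * ⌊v⌋ : ℤ) : ℝ) := by
    push_cast
    rw [Int.fract, Int.fract]
    ring
  rw [this, Int.floor_add_intCast]
  ring

/-- Robust membership forces a single slope `d` for all perturbations: a segment inside the union
cannot jump between the disjoint open triangles. -/
lemma exists_floor_eq_mul_of_mem_progressionRegion {K x y ε : ℝ} (hK : 2 ≤ K) (hε : 0 < ε)
    (h : ∀ δ, |δ| < ε → (y, x + δ) ∈ progressionRegion K) :
    ∃ d : ℤ, 0 ≤ d ∧ ∀ (j : ℕ) (δ : ℝ), (j : ℝ) ≤ K → |δ| < ε → ⌊x + δ + j * y⌋ = j * d := by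
  have h0 := h 0 (by simpa using hε)
  rw [add_zero] at h0
  have hy : y ∈ Set.Ioo (0 : ℝ) 1 := (progressionRegion_subset (by linarith) h0).1
  have hLR := triangleWidth.add_reflect_le_one hK hy
  rcases h0 with ⟨-, hx0, hxL⟩ | ⟨-, hRx, hx1⟩
  · refine ⟨0, le_rfl, fun j δ hj hδ => ?_⟩
    simp only at hx0 hxL
    -- Otherwise some admissible perturbation lands on the boundary of the triangle, which belongs
    -- to neither piece.
    have hxδ : x + δ < triangleWidth K y := by
      by_contra! hcon
      have := h (triangleWidth K y - x)
        (by rw [abs_of_pos (by linarith)]; linarith [le_abs_self δ])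
      rw [add_sub_cancel] at this
      rcases this with ⟨-, h1, h2⟩ | ⟨-, h1, h2⟩
      · exact lt_irrefl _ h2
      · simp only at h1
        linarith
    have hpos : 0 < x + δ := (progressionRegion_subset (by linarith) (h δ hδ)).2.1
    have hlt : x + δ < 1 - K * y := (lt_max_iff.1 hxδ).resolve_left hpos.not_gt
    have hjy : j * y ≤ K * y := mul_le_mul_of_nonneg_right hj hy.1.le
    have : 0 ≤ j * y := mul_nonneg (Nat.cast_nonneg j) hy.1.le
    rw [mul_zero, Int.floor_eq_zero_iff]
    constructor <;> linarith
  · refine ⟨1, zero_le_one, fun j δ hj hδ => ?_⟩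
    simp only at hRx hx1
    have hxδ : 1 - triangleWidth K (1 - y) < x + δ := by
      by_contra! hcon
      have := h (1 - triangleWidth K (1 - y) - x)
        (by rw [abs_of_neg (by linarith)]; linarith [neg_abs_le δ])
      rw [add_sub_cancel] at this
      rcases this with ⟨-, h1, h2⟩ | ⟨-, h1, h2⟩
      · simp only at h2
        linarith
      · exact lt_irrefl _ h1
    have hlt1 : x + δ < 1 := (progressionRegion_subset (by linarith) (h δ hδ)).2.2
    have hlt : 1 - (x + δ) < 1 - K * (1 - y) :=
      (lt_max_iff.1 (by unfold triangleWidth at hxδ; linarith :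
        1 - (x + δ) < max 0 (1 - K * (1 - y)))).resolve_left (by linarith)
    have hjy : j * (1 - y) ≤ K * (1 - y) := mul_le_mul_of_nonneg_right hj (by linarith [hy.2])
    have : 0 ≤ j * (1 - y) := mul_nonneg (Nat.cast_nonneg j) (by linarith [hy.2])
    rw [mul_one, Int.floor_eq_iff]
    push_cast
    constructor <;> linarith

/-- The region says `1 < x + k y < k`. In the application `k - 1` takes the place of `k`. -/
lemma floor_mem_of_mem_nonProgressionRegion {k : ℕ} {x y : ℝ}
    (h : (y, x) ∈ nonProgressionRegion (k : ℝ)) : ⌊x + k * y⌋ ∈ Set.Ioo (0 : ℤ) k := by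
  obtain ⟨-, h1, h2⟩ := h
  have h3 : 1 - k * y ≤ triangleWidth k y := le_max_right _ _
  have h4 : 1 - k * (1 - y) ≤ triangleWidth k (1 - y) := le_max_right _ _
  simp only at h1 h2
  constructor
  · rw [← Int.add_one_le_iff, zero_add, Int.le_floor]
    push_cast
    linarith
  · rw [Int.floor_lt]
    push_cast
    linarith

lemma isDiffConstSeq_one_of_eq {k : ℕ} {a : ℕ → ℤ} {b d : ℤ} (hb : 0 < b) (hd : 0 < d)
    (h : ∀ j < k, a j = b + j * d) : IsDiffConstSeq k 1 a := by
  refine ⟨fun j hj => ?_, fun i hi j hj hij => ?_, d, fun n hn => ?_⟩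
  · rw [h j hj]
    positivity
  · rw [h i hi, h j hj]
    have : (i : ℤ) < j := by exact_mod_cast hij
    nlinarith
  · simp only [Function.iterate_one, fwdDiff]
    rw [h _ hn, h n (by omega)]
    push_cast
    ring

lemma IsDiffConstSeq.exists_eq {k : ℕ} {a : ℕ → ℤ} (h : IsDiffConstSeq k 1 a) :
    ∃ d : ℤ, ∀ j < k, a j = a 0 + j * d := by
  obtain ⟨-, -, d, hd⟩ := h
  refine ⟨d, fun j => ?_⟩
  induction j with
  | zero => simp
  | succ j ih =>
    intro hj
    have h1 := hd j hj
    simp only [Function.iterate_one, fwdDiff] at h1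
    have h2 := ih (by omega)
    push_cast
    linarith

/-- Index `n` of a Cesàro mean stands for the integer `n + 1`, whence the base point `n + 1` in all
the powers. -/
lemma cesaroMean_indicator_one (P : ℕ → Prop) (N : ℕ) :
    cesaroMean (Set.indicator {n | P (n + 1)} (1 : ℕ → ℝ)) N =
      1 / (N : ℝ) * (({n : ℕ | n ∈ Set.Icc 1 N ∧ P n}.ncard : ℕ) : ℝ) := by
  classical
  have h1 : {n : ℕ | n ∈ Set.Icc 1 N ∧ P n} =
      (((Finset.range N).filter fun n => P (n + 1)).map (addRightEmbedding 1) : Finset ℕ) := by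
    ext n
    simp only [Set.mem_ofPred_eq, Set.mem_Icc, Finset.coe_map, addRightEmbedding_apply,
      Finset.coe_filter, Finset.mem_range, Set.mem_image]
    constructor
    · rintro ⟨⟨h1, h2⟩, h3⟩
      exact ⟨n - 1, ⟨by omega, by rwa [Nat.sub_add_cancel h1]⟩, by omega⟩
    · rintro ⟨m, ⟨h1, h2⟩, rfl⟩
      exact ⟨⟨by omega, by omega⟩, h2⟩
  rw [h1, Set.ncard_coe_finset, Finset.card_map, Finset.card_filter, cesaroMean, one_div,
    smul_eq_mul]
  push_cast
  simp [Set.indicator_apply]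

/-! ### From the regions to the density -/

section Main

variable {α : ℝ} {k r : ℕ}

lemma eventually_linear_error_lt (hα : α ∈ Set.Ioo (1 : ℝ) 2) (k r : ℕ) {ε : ℝ} (hε : 0 < ε) :
    ∀ᶠ n : ℕ in atTop, ∀ j < k, ∃ δ, |δ| < ε ∧ (((n + 1 : ℕ) : ℝ) + (r : ℝ) * (j : ℝ)) ^ α =
      ((n : ℝ) + 1) ^ α + j * (r * (α * ((n : ℝ) + 1) ^ (α - 1))) + δ := by
  have h : ∀ᶠ n : ℕ in atTop, ∀ j ∈ Finset.range k, |((n : ℝ) + 1 + r * j) ^ α - ((n : ℝ) + 1) ^ α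
      - r * j * (α * ((n : ℝ) + 1) ^ (α - 1))| < ε := by
    rw [eventually_all_finset]
    intro j _
    have := (tendsto_rpow_linear_error (h := r * j) hα.1.le hα.2 (by positivity)).abs
    rw [abs_zero] at this
    exact this.eventually_lt_const hε
  filter_upwards [h] with n hn j hj
  refine ⟨_, hn j (Finset.mem_range.2 hj), ?_⟩
  push_cast
  ring

lemma eventually_isDiffConstSeq (hα : α ∈ Set.Ioo (1 : ℝ) 2) (hk : 3 ≤ k) (hr : 1 ≤ r)
    {ε : ℝ} (hε : 0 < ε) : ∀ᶠ n : ℕ in atTop,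
      (∀ δ, |δ| < ε → (Int.fract (r * (α * ((n : ℝ) + 1) ^ (α - 1))),
        Int.fract (((n : ℝ) + 1) ^ α) + δ) ∈ progressionRegion ((k : ℝ) - 1)) →
      IsDiffConstSeq k 1 (fun j : ℕ => ⌊(((n + 1 : ℕ) : ℝ) + (r : ℝ) * (j : ℝ)) ^ α⌋) := by
  have hK : (2 : ℝ) ≤ (k : ℝ) - 1 := by
    have : (3 : ℝ) ≤ k := by exact_mod_cast hk
    linarith
  filter_upwards [eventually_linear_error_lt hα k r hε] with n hn hmem
  obtain ⟨d, hd0, hd⟩ := exists_floor_eq_mul_of_mem_progressionRegion hK hε hmem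
  have hn1 : (1 : ℝ) ≤ (n : ℝ) + 1 := by simp
  refine isDiffConstSeq_one_of_eq (b := ⌊((n : ℝ) + 1) ^ α⌋)
    (d := ⌊r * (α * ((n : ℝ) + 1) ^ (α - 1))⌋ + d) ?_ ?_ fun j hj => ?_
  · exact Int.floor_pos.2 (Real.one_le_rpow hn1 (by linarith [hα.1]))
  · have h1 : 1 ≤ ((n : ℝ) + 1) ^ (α - 1) := Real.one_le_rpow hn1 (by linarith [hα.1])
    have h2 : 1 ≤ α * ((n : ℝ) + 1) ^ (α - 1) := one_le_mul_of_one_le_of_one_le hα.1.le h1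
    have : 0 < ⌊r * (α * ((n : ℝ) + 1) ^ (α - 1))⌋ :=
      Int.floor_pos.2 (one_le_mul_of_one_le_of_one_le (by exact_mod_cast hr) h2)
    linarith
  · obtain ⟨δ, hδ, he⟩ := hn j hj
    have hjk : (j : ℝ) ≤ (k : ℝ) - 1 := by
      have : (j : ℝ) + 1 ≤ k := by exact_mod_cast hj
      linarith
    rw [he, Int.floor_add_nat_mul_add, hd j δ hjk hδ]
    ring

lemma eventually_not_isDiffConstSeq (hα : α ∈ Set.Ioo (1 : ℝ) 2) (hk : 3 ≤ k)
    {ε : ℝ} (hε : 0 < ε) : ∀ᶠ n : ℕ in atTop,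
      (∀ δ, |δ| < ε → (Int.fract (r * (α * ((n : ℝ) + 1) ^ (α - 1))),
        Int.fract (((n : ℝ) + 1) ^ α) + δ) ∈ nonProgressionRegion ((k : ℝ) - 1)) →
      ¬ IsDiffConstSeq k 1 (fun j : ℕ => ⌊(((n + 1 : ℕ) : ℝ) + (r : ℝ) * (j : ℝ)) ^ α⌋) := by
  filter_upwards [eventually_linear_error_lt hα k r hε] with n hn hmem hseq
  -- The last term alone gives the obstruction: in a progression, `m` below would be a multiple of
  -- `k - 1` lying strictly between 0 and `k - 1`.
  obtain ⟨δ, hδ, he⟩ := hn (k - 1) (by omega)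
  obtain ⟨d, hd⟩ := hseq.exists_eq
  have h1 := hd (k - 1) (by omega)
  rw [he, Int.floor_add_nat_mul_add] at h1
  have h2 := hmem δ hδ
  rw [← Nat.cast_one, ← Nat.cast_sub (by omega : 1 ≤ k)] at h2
  simp only [Nat.cast_one] at h2
  obtain ⟨h3, h4⟩ := floor_mem_of_mem_nonProgressionRegion h2
  simp only [Nat.cast_zero, mul_zero, add_zero] at h1
  push_cast at h1
  set m := ⌊Int.fract (((n : ℝ) + 1) ^ α) + δ +
    ((k - 1 : ℕ) : ℝ) * Int.fract (r * (α * ((n : ℝ) + 1) ^ (α - 1)))⌋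
  have hdvd : ((k - 1 : ℕ) : ℤ) ∣ m :=
    ⟨d - ⌊r * (α * ((n : ℝ) + 1) ^ (α - 1))⌋, by linarith⟩
  exact absurd (Int.le_of_dvd h3 hdvd) (by omega)

end Main

theorem corollary1 (α : ℝ) (hα : α ∈ Set.Ioo (1 : ℝ) 2) (k : ℕ) (hk : 3 ≤ k)
    (r : ℕ) (hr : 1 ≤ r) :
    Filter.Tendsto
      (fun N : ℕ => (1 / (N : ℝ)) *
        (({n : ℕ | n ∈ Set.Icc 1 N ∧
          IsDiffConstSeq k 1 (fun j : ℕ => ⌊((n : ℝ) + (r : ℝ) * (j : ℝ)) ^ α⌋)}.ncard : ℕ) : ℝ))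
      Filter.atTop (nhds (1 / ((k : ℝ) - 1))) := by
  have hK : (2 : ℝ) ≤ (k : ℝ) - 1 := by
    have : (3 : ℝ) ≤ k := by exact_mod_cast hk
    linarith
  simp only [← cesaroMean_indicator_one
    (fun n : ℕ => IsDiffConstSeq k 1 (fun j : ℕ => ⌊((n : ℝ) + (r : ℝ) * (j : ℝ)) ^ α⌋))]
  set A : Set ℕ := {n | IsDiffConstSeq k 1
    (fun j : ℕ => ⌊(((n + 1 : ℕ) : ℝ) + (r : ℝ) * (j : ℝ)) ^ α⌋)} with hA
  let z : ℕ → ℝ × ℝ := fun n => (r * (α * ((n : ℝ) + 1) ^ (α - 1)), ((n : ℝ) + 1) ^ α)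
  have hz (a b : ℤ) (hab : ¬ (a = 0 ∧ b = 0)) :
      Tendsto (cesaroMean fun n => expTwoPiI (a * (z n).1 + b * (z n).2)) atTop (𝓝 0) :=
    tendsto_cesaroMean_expTwoPiI_rpow_add_deriv hα.1 hα.2 (by positivity)
      (fun h => hab ⟨h.2, h.1⟩)
  -- The lower bound comes from visits to the triangles, the upper bound from visits to the
  -- complementary region, through `Aᶜ`.
  rw [tendsto_order]
  constructor
  · intro c hc
    rw [← volume_progressionRegion hK] at hc
    exact eventually_lt_cesaroMean_indicator hz (isOpen_progressionRegion _)
      (progressionRegion_subset (by linarith))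
      (fun ε hε => eventually_isDiffConstSeq hα hk hr hε) hc
  · intro c hc
    have hc' : 1 - c < volume.real (nonProgressionRegion ((k : ℝ) - 1)) := by
      rw [volume_nonProgressionRegion hK]
      linarith
    have h := eventually_lt_cesaroMean_indicator (A := Aᶜ) hz (isOpen_nonProgressionRegion _)
      (nonProgressionRegion_subset _)
      (fun ε hε => eventually_not_isDiffConstSeq hα hk hε) hc'
    filter_upwards [h, eventually_ge_atTop 1] with N hN hN1
    have hsum : cesaroMean (fun n => A.indicator (1 : ℕ → ℝ) n + Aᶜ.indicator 1 n) N = 1 := by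
      have hN0 : (N : ℝ) ≠ 0 := by positivity
      simp [cesaroMean, Set.indicator_self_add_compl_apply, hN0]
    rw [cesaroMean.add] at hsum
    linarith
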